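/- Let $G_1(u)=\sum_{k\ge 1}a_k u^k$ and $G_2(u)=\sum_{k\ge 1}b_k u^{k+1}$ be formal power series with real coefficients such that the product $G_1(u)G_2(u)$ is not identically zero (equivalently, $G_1\not\equiv 0$ and $G_2\not\equiv 0$). Consider the planar formal system $$\dot u = v+G_2(u),\qquad \dot v = 2\,v\,G_1(u),$$ with associated formal vector field $\mathbf P(u,v)=(v+G_2(u),\,2vG_1(u))^T$. Then this system has no formal inverse integrating factor of the form $V=v+\cdots$; that is, there is no formal power series $V\in\mathbb R[[u,v]]$ of the form $V = v + (\text{terms of total degree at least } 2 \text{ in } (u,v))$ such that $$\nabla V\cdot \mathbf P = \operatorname{div}(\mathbf P)\,V .$$ -/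

import Mathlib

/-- A formal vector field `F = (F_i)` in the variables indexed by `σ`, with real coefficients:
every component is a formal power series. -/
abbrev FormalVectorField (σ : Type*) := σ → MvPowerSeries σ ℝ

namespace FormalVectorField

variable {σ : Type*} [Fintype σ]

/-- The divergence `∑ ∂F_i/∂x_i`. -/
noncomputable def divergence (F : FormalVectorField σ) : MvPowerSeries σ ℝ :=
  ∑ i, MvPowerSeries.pderiv ℝ i (F i)

/-- The Lie derivative `∇V · F = ∑ (∂V/∂x_i) F_i`. -/
noncomputable def lieDerivative (F : FormalVectorField σ) (V : MvPowerSeries σ ℝ) :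
    MvPowerSeries σ ℝ :=
  ∑ i, MvPowerSeries.pderiv ℝ i V * F i

/-- `V` is a formal inverse Jacobi multiplier of `F` (for planar fields: a formal inverse
integrating factor): `∇V · F = div(F) V`. -/
def IsInverseIntegratingFactor (F : FormalVectorField σ) (V : MvPowerSeries σ ℝ) : Prop :=
  F.lieDerivative V = F.divergence * V

end FormalVectorField

/-- The coordinate `u` of the plane, as a formal power series in `(u, v)`. -/
noncomputable abbrev coordU : MvPowerSeries (Fin 2) ℝ := MvPowerSeries.X 0

/-- The coordinate `v` of the plane, as a formal power series in `(u, v)`. -/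
noncomputable abbrev coordV : MvPowerSeries (Fin 2) ℝ := MvPowerSeries.X 1

/-- The planar formal vector field `P(u, v) = (v + G₂(u), 2 v G₁(u))`. -/
noncomputable def planarField (G₁ G₂ : PowerSeries ℝ) : FormalVectorField (Fin 2) :=
  ![coordV + G₂.subst coordU, 2 * coordV * G₁.subst coordU]

/-- `V = v + ⋯`, where the dots stand for terms of total degree at least two in `(u, v)`. -/
def HasLeadingTermV (V : MvPowerSeries (Fin 2) ℝ) : Prop :=
  2 ≤ (V - coordV).order

/-! Write `V` as the sum of `U k * v ^ k` with each `U k` a series in `u`, `G = G₂`, and `W(T) = G *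
euler T - euler G * T`. The equation for `V` becomes `W(U 0) = 2 u G₁ U 0` and `W(U (k+1)) = -euler
(U k) - 2 k u G₁ U (k+1)`. Let `n` and `p` be the orders of `G` and `G₁`. Since `W(G) = 0`,
multiples of `G` can be removed from `T`; the remainder has order `j ≠ n`, and then `W` has order
exactly `n + j` (`order_wronskian`). Hence, modulo constants and multiples of `G`, `U k` has order
`p + 1 - n k`. The order drops by `n ≥ 1` at each step yet must stay positive, a contradiction
(`not_exists_slices`). -/

namespace PowerSeries

/-! ### Orders of Wronskians and the descent -/

/-- The Euler operator, sending a power series to `X` times its derivative. -/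
noncomputable def euler (f : PowerSeries ℝ) : PowerSeries ℝ := X * derivative ℝ f

theorem coeff_euler (f : PowerSeries ℝ) (n : ℕ) : coeff n (euler f) = n * coeff n f := by
  cases n with
  | zero => simp [euler]
  | succ n =>
    rw [euler, coeff_succ_X_mul, coeff_derivative]
    push_cast
    ring

theorem euler_add (f g : PowerSeries ℝ) : euler (f + g) = euler f + euler g := by
  simp [euler, mul_add]

theorem euler_C_mul (c : ℝ) (f : PowerSeries ℝ) : euler (C c * f) = C c * euler f := by
  ext n
  simp only [coeff_euler, coeff_C_mul]
  ring

theorem euler_sub_C (f : PowerSeries ℝ) (c : ℝ) : euler (f - C c) = euler f := by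
  simp [euler]

theorem le_order_euler (f : PowerSeries ℝ) : f.order ≤ (euler f).order :=
  le_order _ _ fun i hi => by rw [coeff_euler, coeff_of_lt_order i hi, mul_zero]

theorem order_euler {f : PowerSeries ℝ} {q : ℕ} (hq : q ≠ 0) (hf : f.order = q) :
    (euler f).order = q := by
  rw [order_eq_nat] at hf ⊢
  refine ⟨?_, fun i hi => by rw [coeff_euler, hf.2 i hi, mul_zero]⟩
  rw [coeff_euler]
  exact mul_ne_zero (Nat.cast_ne_zero.mpr hq) hf.1

theorem coeff_add_mul_of_le_order {f g : PowerSeries ℝ} {a b : ℕ}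
    (hf : a ≤ f.order) (hg : b ≤ g.order) :
    coeff (a + b) (f * g) = coeff a f * coeff b g := by
  rw [coeff_mul, Finset.sum_eq_single (a, b)]
  · rintro ⟨i, j⟩ hij hne
    rw [Finset.HasAntidiagonal.mem_antidiagonal] at hij
    dsimp only at hij ⊢
    rcases lt_or_ge i a with hi | hi
    · rw [coeff_of_lt_order i (lt_of_lt_of_le (by exact_mod_cast hi) hf), zero_mul]
    · rcases lt_or_ge j b with hj | hj
      · rw [coeff_of_lt_order j (lt_of_lt_of_le (by exact_mod_cast hj) hg), mul_zero]
      · exact absurd (Prod.ext (by dsimp only; omega) (by dsimp only; omega)) hne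
  · simp

/-- The Wronskian of two power series of distinct orders has the sum of the orders as its order
(when taken with respect to the Euler operator). -/
theorem order_wronskian {G S : PowerSeries ℝ} {n j : ℕ} (hG : G.order = n) (hS : S.order = j)
    (hne : j ≠ n) : (G * euler S - euler G * S).order = ((n + j : ℕ) : ℕ∞) := by
  have hGn := (order_eq_nat.mp hG).1
  have hSj := (order_eq_nat.mp hS).1
  have hG' : (n : ℕ∞) ≤ (euler G).order := hG ▸ le_order_euler G
  have hS' : (j : ℕ∞) ≤ (euler S).order := hS ▸ le_order_euler S
  rw [order_eq_nat]
  constructor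
  · rw [map_sub, coeff_add_mul_of_le_order hG.ge hS', coeff_add_mul_of_le_order hG' hS.ge,
      coeff_euler, coeff_euler]
    have : coeff n G * (j * coeff j S) - n * coeff n G * coeff j S
        = ((j : ℝ) - n) * (coeff n G * coeff j S) := by ring
    rw [this]
    exact mul_ne_zero (sub_ne_zero.mpr (by exact_mod_cast hne)) (mul_ne_zero hGn hSj)
  · intro i hi
    have hi' : (i : ℕ∞) < (n : ℕ∞) + j := by exact_mod_cast hi
    rw [map_sub, coeff_of_lt_order i, coeff_of_lt_order i, sub_zero]
    · exact (hi'.trans_le (add_le_add hG' hS.ge)).trans_le (le_order_mul _ _)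
    · exact (hi'.trans_le (add_le_add hG.ge hS')).trans_le (le_order_mul _ _)

theorem order_add_eq_left {f g : PowerSeries ℝ} (h : f.order < g.order) :
    (f + g).order = f.order := by
  rw [order_add_of_order_ne _ _ h.ne, inf_eq_left.mpr h.le]

/-- Removing a multiple of `G` from a solution `T` of a Wronskian equation leaves a series whose
order is determined by the order of the right-hand side. -/
theorem exists_order_of_wronskian_eq {G T R : PowerSeries ℝ} {n q : ℕ} (hG : G.order = n)
    (hR : R.order = q) (h : G * euler T - euler G * T = R) :
    ∃ (c : ℝ) (S : PowerSeries ℝ) (j : ℕ),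
      T = C c * G + S ∧ S.order = j ∧ j ≠ n ∧ q = n + j := by
  have hGn := (order_eq_nat.mp hG).1
  -- This `c` cancels the coefficient of `u ^ n`, so the remainder cannot have order `n`.
  obtain ⟨c, hc⟩ : ∃ c, c * coeff n G = coeff n T := ⟨_, div_mul_cancel₀ _ hGn⟩
  have hW : G * euler (T - C c * G) - euler G * (T - C c * G) = R := by
    have : euler T = C c * euler G + euler (T - C c * G) := by
      rw [← euler_C_mul, ← euler_add]
      congr 1
      ring
    rw [this] at h
    rw [← h]
    ring
  have hS0 : T - C c * G ≠ 0 := by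
    intro h0
    rw [h0] at hW
    have : R = 0 := by rw [← hW]; simp [euler]
    rw [this, order_zero] at hR
    exact ENat.top_ne_natCast _ hR
  have hSj := (coe_toNat_order hS0).symm
  have hjn : (T - C c * G).order.toNat ≠ n := by
    intro hj
    apply coeff_order hS0
    rw [hj, map_sub, coeff_C_mul, hc, sub_self]
  refine ⟨c, T - C c * G, _, by ring, hSj, hjn, ?_⟩
  have := order_wronskian hG hSj hjn
  rw [hW, hR] at this
  exact_mod_cast this

/-- There are no coefficients `U k` of `v ^ k` for an inverse integrating factor `v + ⋯`. -/
theorem not_exists_slices {G₁ G : PowerSeries ℝ} (hG₁ : G₁ ≠ 0) (hG : G ≠ 0)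
    (hG0 : coeff 0 G = 0) (U : ℕ → PowerSeries ℝ)
    (hU0 : coeff 0 (U 0) = 0) (hU1 : coeff 0 (U 1) = 1)
    (h0 : G * euler (U 0) = (euler G + 2 * (X * G₁)) * U 0)
    (hk : ∀ k : ℕ, euler (U k) + G * euler (U (k + 1)) + 2 * (k : PowerSeries ℝ) * (X * G₁) * U (k + 1)
      = euler G * U (k + 1)) : False := by
  obtain ⟨n, hn⟩ : ∃ n : ℕ, G.order = n := ⟨_, (coe_toNat_order hG).symm⟩
  obtain ⟨p, hp⟩ : ∃ p : ℕ, G₁.order = p := ⟨_, (coe_toNat_order hG₁).symm⟩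
  have hGn := order_eq_nat.mp hn
  have hn0 : n ≠ 0 := by
    rintro rfl
    exact hGn.1 hG0
  have hp1 : (X * G₁).order = ((p + 1 : ℕ) : ℕ∞) := by
    rw [order_mul, order_X, hp]
    push_cast
    ring
  -- the lowest-order part of `U 0` is that of `G`
  have hE : euler (U 0) = euler G * U 1 - G * euler (U 1) := by
    have := hk 0
    rw [Nat.cast_zero, zero_add] at this
    linear_combination this
  have hGe : (n : ℕ∞) ≤ (euler G).order := hn ▸ le_order_euler G
  have hU0n : ∀ i ≤ n, coeff i (U 0) = coeff i G := by
    intro i hi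
    rcases Nat.eq_zero_or_pos i with rfl | hi0
    · rw [hU0, hG0]
    have hi0' : (i : ℝ) ≠ 0 := by positivity
    apply mul_left_cancel₀ hi0'
    rw [← coeff_euler, ← coeff_euler, hE]
    -- For `i ≤ n` only the constant terms of `U 1` and `euler (U 1)`, namely `1` and `0`,
    -- contribute.
    have e1 := coeff_add_mul_of_le_order (f := euler G) (g := U 1) (a := i) (b := 0)
      (le_trans (by exact_mod_cast hi) hGe) (by simp)
    have e2 := coeff_add_mul_of_le_order (f := G) (g := euler (U 1)) (a := i) (b := 0)
      (le_trans (by exact_mod_cast hi) hn.ge) (by simp)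
    rw [add_zero] at e1 e2
    rw [map_sub, e1, e2, hU1, coeff_euler (U 1)]
    simp
  have hU0o : (U 0).order = n := by
    rw [order_eq_nat]
    refine ⟨by rw [hU0n n le_rfl]; exact hGn.1, fun i hi => ?_⟩
    rw [hU0n i hi.le, hGn.2 i hi]
  -- the correction term to `U k` has order `p + 1 - n k`
  have key : ∀ k : ℕ, ∃ (c : ℝ) (S : PowerSeries ℝ) (q : ℕ),
      euler (U k) = C c * euler G + euler S ∧ S.order = q ∧ q ≠ n ∧ q ≠ 0 ∧ q + n * k = p + 1 := by
    intro k
    induction k with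
    | zero =>
      have hR : (2 * (X * G₁) * U 0).order = ((p + 1 + n : ℕ) : ℕ∞) := by
        have h2 : (2 : PowerSeries ℝ).order = 0 := by
          apply order_zero_of_unit
          rw [isUnit_iff_constantCoeff]
          rw [map_ofNat]
          exact IsUnit.mk0 _ two_ne_zero
        rw [order_mul, order_mul, h2, hp1, hU0o]
        push_cast
        ring
      obtain ⟨c, S, j, hT, hSj, hjn, hq⟩ := exists_order_of_wronskian_eq hn hR
        (T := U 0) (by rw [h0]; ring)
      exact ⟨c, S, j, by rw [hT, euler_add, euler_C_mul], hSj, hjn, by omega, by omega⟩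
    | succ k ih =>
      obtain ⟨c, S, q, hU, hS, hqn, hq0, hq⟩ := ih
      have hR : (-(euler S) + -(2 * (k : PowerSeries ℝ) * (X * G₁) * U (k + 1))).order = (q : ℕ∞) := by
        have hSe : (-(euler S)).order = q := by rw [order_neg, order_euler hq0 hS]
        rw [order_add_eq_left, hSe]
        -- The `G₁` term vanishes for `k = 0`; for `k ≥ 1` its order is at least `p + 1 = q + n * k
        -- > q`.
        rw [hSe, order_neg]
        rcases Nat.eq_zero_or_pos k with rfl | hk0
        · simp
        have h1 : (X * G₁).order ≤ (2 * (k : PowerSeries ℝ) * (X * G₁) * U (k + 1)).order := by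
          rw [order_mul _ (U (k + 1)), order_mul _ (X * G₁)]
          exact le_add_self.trans le_self_add
        refine lt_of_lt_of_le ?_ h1
        rw [hp1]
        have := Nat.mul_pos (Nat.pos_of_ne_zero hn0) hk0
        exact_mod_cast (by omega : q < p + 1)
      -- Subtracting the constant `c` adds `c * euler G` to the Wronskian, cancelling the `G` part
      -- of `euler (U k)`.
      obtain ⟨d, S', j, hT, hSj, hjn, hq'⟩ := exists_order_of_wronskian_eq hn hR
        (T := U (k + 1) - C c) (by
          rw [euler_sub_C]
          have := hk k
          rw [hU] at this
          linear_combination this)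
      refine ⟨d, S', j, ?_, hSj, hjn, by omega, by rw [mul_add]; omega⟩
      rw [← euler_sub_C _ c, hT, euler_add, euler_C_mul]
  obtain ⟨-, -, q, -, -, -, hq0, hq⟩ := key (p + 1)
  have := Nat.le_mul_of_pos_left (p + 1) (Nat.pos_of_ne_zero hn0)
  omega

end PowerSeries

/-! ### Expansion in powers of `v` -/

namespace MvPowerSeries

open Finsupp

/-- The coefficient of `v ^ k` in a power series in `(u, v)`, as a power series in `u`. -/
noncomputable def slice (k : ℕ) : MvPowerSeries (Fin 2) ℝ →ₗ[ℝ] PowerSeries ℝ where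
  toFun V := PowerSeries.mk fun i => coeff (single 0 i + single 1 k) V
  map_add' V W := by ext; simp
  map_smul' c V := by ext; simp

theorem coeff_slice (k i : ℕ) (V : MvPowerSeries (Fin 2) ℝ) :
    PowerSeries.coeff i (slice k V) = coeff (single 0 i + single 1 k) V := by
  simp [slice]

theorem coeff_subst_coordU (G : PowerSeries ℝ) (m : Fin 2 →₀ ℕ) :
    coeff m (G.subst coordU) = if m 1 = 0 then PowerSeries.coeff (m 0) G else 0 := by
  classical
  rw [PowerSeries.coeff_subst (PowerSeries.HasSubst.X 0)]
  simp only [coeff_X_pow, smul_eq_mul, mul_ite, mul_one, mul_zero]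
  split_ifs with h
  · rw [finsum_eq_single _ (m 0)]
    · rw [if_pos]
      refine Finsupp.ext fun i => ?_
      fin_cases i <;> simp [h]
    · intro d hd
      rw [if_neg]
      rintro rfl
      simp at hd
  · refine finsum_eq_zero_of_forall_eq_zero fun d => ?_
    rw [if_neg]
    rintro rfl
    simp at h

/-- A series in `u` alone has no positive power of `v`, so in the product `V` must supply all of `v
^ k`. -/
theorem slice_subst_mul (k : ℕ) (G : PowerSeries ℝ) (V : MvPowerSeries (Fin 2) ℝ) :
    slice k (G.subst coordU * V) = G * slice k V := by
  classical
  ext i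
  rw [coeff_slice, coeff_mul, PowerSeries.coeff_mul]
  symm
  apply Finset.sum_of_injOn
    (fun x : ℕ × ℕ => ((single 0 x.1, single 0 x.2 + single 1 k) : (Fin 2 →₀ ℕ) × (Fin 2 →₀ ℕ)))
  · rintro ⟨a, b⟩ - ⟨a', b'⟩ - h
    simp only [Prod.mk.injEq] at h
    have h1 := DFunLike.congr_fun h.1 0
    have h2 := DFunLike.congr_fun h.2 0
    simp at h1 h2
    simp [h1, h2]
  · rintro ⟨a, b⟩ hab
    rw [Finset.mem_coe, Finset.HasAntidiagonal.mem_antidiagonal] at hab ⊢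
    rw [← hab, single_add, add_assoc]
  · rintro ⟨a, b⟩ hab hn
    rw [coeff_subst_coordU, if_neg, zero_mul]
    intro ha
    apply hn
    rw [Finset.HasAntidiagonal.mem_antidiagonal] at hab
    have e0 := DFunLike.congr_fun hab 0
    have e1 := DFunLike.congr_fun hab 1
    simp at e0 e1 ha
    refine ⟨(a 0, b 0), by simpa using e0, ?_⟩
    refine Prod.ext (Finsupp.ext fun l => ?_) (Finsupp.ext fun l => ?_)
    · fin_cases l <;> simp [ha]
    · fin_cases l
      · simp
      · simp
        omega
  · rintro ⟨a, b⟩ -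
    rw [coeff_subst_coordU, coeff_slice]
    simp

theorem slice_pderiv_zero (k : ℕ) (V : MvPowerSeries (Fin 2) ℝ) :
    slice k (pderiv ℝ 0 V) = PowerSeries.derivative ℝ (slice k V) := by
  ext i
  rw [coeff_slice, coeff_pderiv, PowerSeries.coeff_derivative, coeff_slice, add_right_comm,
    ← single_add]
  simp

theorem slice_zero_coordV_mul (V : MvPowerSeries (Fin 2) ℝ) : slice 0 (coordV * V) = 0 := by
  classical
  ext i
  rw [coeff_slice, coordV, X, coeff_monomial_mul, if_neg]
  · simp
  · intro hle
    have := hle 1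
    simp at this

theorem slice_succ_coordV_mul (k : ℕ) (V : MvPowerSeries (Fin 2) ℝ) :
    slice (k + 1) (coordV * V) = slice k V := by
  ext i
  rw [coeff_slice, coeff_slice, single_add, ← add_assoc, add_comm _ (single 1 1), coordV, X,
    coeff_add_monomial_mul, one_mul]

theorem slice_coordV_mul_pderiv_one (k : ℕ) (V : MvPowerSeries (Fin 2) ℝ) :
    slice k (coordV * pderiv ℝ 1 V) = k * slice k V := by
  cases k with
  | zero => simp [slice_zero_coordV_mul]
  | succ k =>
    rw [slice_succ_coordV_mul]
    ext i
    rw [coeff_slice, coeff_pderiv, add_assoc, ← single_add, ← nsmul_eq_mul, map_nsmul, coeff_slice,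
      nsmul_eq_mul, mul_comm]
    simp

theorem pderiv_zero_subst_coordU (G : PowerSeries ℝ) :
    pderiv ℝ 0 (G.subst coordU) = (PowerSeries.derivative ℝ G).subst coordU := by
  ext m
  rw [coeff_pderiv, coeff_subst_coordU, coeff_subst_coordU, PowerSeries.coeff_derivative]
  simp

theorem pderiv_one_subst_coordU (G : PowerSeries ℝ) : pderiv ℝ 1 (G.subst coordU) = 0 := by
  ext m
  rw [coeff_pderiv, coeff_subst_coordU]
  simp

/-- The equation for an inverse integrating factor of the planar field, coefficientwise in `v`. -/
theorem slice_equation {G₁ G₂ : PowerSeries ℝ} {V : MvPowerSeries (Fin 2) ℝ}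
    (h : (planarField G₁ G₂).IsInverseIntegratingFactor V) (k : ℕ) :
    slice k (coordV * pderiv ℝ 0 V) + G₂ * PowerSeries.derivative ℝ (slice k V)
      + 2 * (G₁ * (k * slice k V))
      = PowerSeries.derivative ℝ G₂ * slice k V + 2 * (G₁ * slice k V) := by
  have hdiv : (planarField G₁ G₂).divergence
      = (PowerSeries.derivative ℝ G₂).subst coordU + 2 * G₁.subst coordU := by
    have h10 : pderiv ℝ (0 : Fin 2) coordV = 0 := pderiv_X_of_ne (by decide)
    have h11 : pderiv ℝ (1 : Fin 2) coordV = 1 := pderiv_X_self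
    have h2 : pderiv ℝ (1 : Fin 2) (2 : MvPowerSeries (Fin 2) ℝ) = 0 := by
      simpa using (pderiv ℝ (1 : Fin 2)).map_natCast 2
    simp [FormalVectorField.divergence, planarField, Fin.sum_univ_two, Derivation.leibniz,
      h10, h11, h2, pderiv_zero_subst_coordU, pderiv_one_subst_coordU, mul_comm]
  have hlie : (planarField G₁ G₂).lieDerivative V = coordV * pderiv ℝ 0 V
      + G₂.subst coordU * pderiv ℝ 0 V
      + (2 : ℝ) • (G₁.subst coordU * (coordV * pderiv ℝ 1 V)) := by
    simp only [FormalVectorField.lieDerivative, planarField, Fin.sum_univ_two,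
      Matrix.cons_val_zero, Matrix.cons_val_one, two_smul]
    ring
  have hrhs : (planarField G₁ G₂).divergence * V
      = (PowerSeries.derivative ℝ G₂).subst coordU * V + (2 : ℝ) • (G₁.subst coordU * V) := by
    rw [hdiv, two_smul]
    ring
  have := congrArg (slice k) (hlie.symm.trans (h.trans hrhs))
  simp only [map_add, map_smul, slice_subst_mul, slice_pderiv_zero,
    slice_coordV_mul_pderiv_one] at this
  simpa only [two_smul, two_mul] using this

end MvPowerSeries

/-! ### Assembly -/

theorem HasLeadingTermV.coeff_eq {V : MvPowerSeries (Fin 2) ℝ} (hV : HasLeadingTermV V)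
    {m : Fin 2 →₀ ℕ} (hm : m.degree < 2) :
    MvPowerSeries.coeff m V = MvPowerSeries.coeff m coordV := by
  have := MvPowerSeries.coeff_of_lt_order (lt_of_lt_of_le (by exact_mod_cast hm) hV)
  rwa [map_sub, sub_eq_zero] at this

theorem mainTheorem8 (G₁ G₂ : PowerSeries ℝ)
    (hG₁ : PowerSeries.coeff 0 G₁ = 0)
    (hG₂₀ : PowerSeries.coeff 0 G₂ = 0) (hG₂₁ : PowerSeries.coeff 1 G₂ = 0)
    (hG : G₁ * G₂ ≠ 0) :
    ¬ ∃ V : MvPowerSeries (Fin 2) ℝ,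
      HasLeadingTermV V ∧ (planarField G₁ G₂).IsInverseIntegratingFactor V := by
  classical
  rintro ⟨V, hV, h⟩
  refine PowerSeries.not_exists_slices (left_ne_zero_of_mul hG) (right_ne_zero_of_mul hG) hG₂₀
    (fun k => MvPowerSeries.slice k V) ?_ ?_ ?_ fun k => ?_
  · rw [MvPowerSeries.coeff_slice, hV.coeff_eq (by simp)]
    simp [coordV]
  · rw [MvPowerSeries.coeff_slice, hV.coeff_eq (by simp)]
    simp [coordV]
  · have := MvPowerSeries.slice_equation h 0
    rw [MvPowerSeries.slice_zero_coordV_mul] at this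
    simp only [PowerSeries.euler, Nat.cast_zero] at this ⊢
    -- Multiplication by `u` turns derivatives into Euler operators.
    linear_combination PowerSeries.X * this
  -- At `v ^ (k + 1)` the divergence term `2 G₁` cancels one of the `k + 1` copies of `2 G₁ U (k +
  -- 1)`, leaving the factor `k`.
  · have := MvPowerSeries.slice_equation h (k + 1)
    rw [MvPowerSeries.slice_succ_coordV_mul, MvPowerSeries.slice_pderiv_zero] at this
    simp only [PowerSeries.euler]
    push_cast at this
    linear_combination PowerSeries.X * this
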